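/- Let $(\mathcal C,\mathbb E,\mathfrak s)$ be an extriangulated category (in the sense of Nakaoka–Palu) which is Krull–Schmidt and has enough projectives and enough injectives. For $i\ge 0$ write $\mathbb E^{i+1}(X,Y)=\mathbb E(\Omega^iX,Y)$, where $\Omega^iX$ is an $i$-th syzygy of $X$. Let $\omega\subseteq\mathcal C$ be a full additive subcategory, closed under isomorphisms and direct summands, which is self-orthogonal, i.e. $\mathbb E^i(X,Y)=0$ for all $X,Y\in\omega$ and all $i\ge 1$. Put $\omega^{\bot}=\{Y\in\mathcal C\mid \mathbb E^i(X,Y)=0\ \text{for all } X\in\omega,\ i\ge1\}$. For a class $\mathcal Y$ of objects of $\mathcal C$, let $\hat{\mathcal Y}$ be the class of objects $A$ for which there are $n\ge 0$ and $\mathbb E$-triangles $K_{i+1}\to W_i\to K_i\dashrightarrow$ $(0\le i<n)$ with $K_0=A$, $W_i\in\mathcal Y$ for all $i<n$, and $K_n\in\mathcal Y$. Dually, let $\check{\mathcal Y}$ be the class of objects $A$ for which there are $n\ge 0$ and $\mathbb E$-triangles $K^{i}\to W^i\to K^{i+1}\dashrightarrow$ $(0\le i<n)$ with $K^0=A$,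 $W^i\in\mathcal Y$ for all $i<n$, and $K^n\in\mathcal Y$. Put $\widetilde\omega=\check{\hat\omega}$, the result of applying $\check{(\ )}$ to $\hat\omega$. Let ${}_\omega\mathcal X$ be the class of objects $A$ for which there are $\mathbb E$-triangles $K_{i+1}\to W_i\to K_i\dashrightarrow$ $(i\ge 0)$ with $K_0\cong A$ and with $W_i\in\omega$ and $K_i\in\omega^{\bot}$ for all $i\ge 0$. Then for every object $M$ of $\mathcal C$ the following are equivalent: 1. $M\in\widetilde\omega$; 2. there is an $\mathbb E$-triangle $U\to V\to M\dashrightarrow$ with $U\in\hat\omega$ and $V\in\check\omega$; 3. there is an $\mathbb E$-triangle $M\to U'\to V'\dashrightarrow$ with $U'\in\hat\omega$ and $V'\in\check\omega$. Likewise, the following are equivalent: 1. $M\in\check{{}_\omega\mathcal X}$, the result of applying $\check{(\ )}$ to ${}_\omega\mathcal X$; 2. there is an $\mathbb E$-triangle $U\to V\to M\dashrightarrow$ with $U\in{}_\omega\mathcal X$ and $V\in\check\omega$; 3. there is an $\mathbb E$-triangle $M\to U'\to V'\dashrightarrow$ with $U'\in{}_\omega\mathcal X$ and $V'\in\check\omega$.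 -/

import Mathlib

open CategoryTheory CategoryTheory.Limits Opposite

universe w v u

namespace Extri

section Bifunctor

variable {C : Type u} [Category.{v} C] [Preadditive C]
  [HasFiniteBiproducts C] [HasBinaryBiproducts C]

/-- The group `𝔼(X, A)` of extensions of a bifunctor `𝔼 : Cᵒᵖ × C → Ab` (in curried form). -/
abbrev Ext (E : Cᵒᵖ ⥤ C ⥤ AddCommGrpCat.{w}) (X A : C) : Type w := (E.obj (op X)).obj A

/-- `a_* δ`. -/
def push (E : Cᵒᵖ ⥤ C ⥤ AddCommGrpCat.{w}) {X A A' : C} (a : A ⟶ A') (δ : Ext E X A) :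
    Ext E X A' := ((E.obj (op X)).map a).hom δ

/-- `c^* δ`. -/
def pull (E : Cᵒᵖ ⥤ C ⥤ AddCommGrpCat.{w}) {X X' A : C} (c : X' ⟶ X) (δ : Ext E X A) :
    Ext E X' A := ((E.map c.op).app A).hom δ

/-- The direct sum `δ ⊕ δ' ∈ 𝔼(X ⊕ X', A ⊕ A')`, the element corresponding to `(δ, 0, 0, δ')`
under `𝔼(X ⊕ X', A ⊕ A') ≅ 𝔼(X, A) ⊕ 𝔼(X, A') ⊕ 𝔼(X', A) ⊕ 𝔼(X', A')`. -/
noncomputable def extSum (E : Cᵒᵖ ⥤ C ⥤ AddCommGrpCat.{w}) {X X' A A' : C}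
    (δ : Ext E X A) (δ' : Ext E X' A') : Ext E (X ⊞ X') (A ⊞ A') :=
  push E biprod.inl (pull E biprod.fst δ) + push E biprod.inr (pull E biprod.snd δ')

/-- A sequence of morphisms `A ⟶ B ⟶ X` with fixed end terms. -/
structure Seq (A X : C) where
  B : C
  x : A ⟶ B
  y : B ⟶ X

/-- Equivalence of sequences: an isomorphism of the middle terms that is compatible with the
identities of the end terms. -/
def Seq.Equivalent {A X : C} (S T : Seq A X) : Prop :=
  ∃ b : S.B ≅ T.B, S.x ≫ b.hom = T.x ∧ b.hom ≫ T.y = S.y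

instance seqSetoid (A X : C) : Setoid (Seq A X) where
  r := Seq.Equivalent
  iseqv :=
    { refl := fun S => ⟨Iso.refl _, by simp, by simp⟩
      symm := by
        rintro S T ⟨b, h1, h2⟩
        exact ⟨b.symm, by simp [← h1], by simp [← h2]⟩
      trans := by
        rintro S T U ⟨b, h1, h2⟩ ⟨c, h3, h4⟩
        exact ⟨b ≪≫ c, by simp [← h3, ← h1], by simp [h4, h2]⟩ }

/-- The set of equivalence classes `[A ⟶ B ⟶ X]`. -/
abbrev SeqClass (A X : C) := Quotient (seqSetoid A X)

/-- The class `[A ⟶ B ⟶ X]`. -/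
def seqClass {A B X : C} (x : A ⟶ B) (y : B ⟶ X) : SeqClass A X := Quotient.mk _ ⟨B, x, y⟩

end Bifunctor

/-- An extriangulated structure `(𝔼, 𝔰)` on an additive category `C`. -/
structure ExtriangulatedStructure (C : Type u) [Category.{v} C] [Preadditive C]
    [HasFiniteBiproducts C] [HasBinaryBiproducts C] where
  /-- (ET1) the biadditive functor `𝔼` -/
  E : Cᵒᵖ ⥤ C ⥤ AddCommGrpCat.{w}
  push_add : ∀ {X A A' : C} (a b : A ⟶ A') (δ : Ext E X A),
    push E (a + b) δ = push E a δ + push E b δ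
  pull_add : ∀ {X X' A : C} (c d : X' ⟶ X) (δ : Ext E X A),
    pull E (c + d) δ = pull E c δ + pull E d δ
  /-- (ET2) the additive realization `𝔰` -/
  s : ∀ {X A : C}, Ext E X A → SeqClass A X
  realize_hom : ∀ {A B X A' B' X' : C} (x : A ⟶ B) (y : B ⟶ X) (δ : Ext E X A)
    (x' : A' ⟶ B') (y' : B' ⟶ X') (δ' : Ext E X' A'),
    s δ = seqClass x y → s δ' = seqClass x' y' →
    ∀ (a : A ⟶ A') (c : X ⟶ X'), push E a δ = pull E c δ' →
      ∃ b : B ⟶ B', x ≫ b = a ≫ x' ∧ y ≫ c = b ≫ y'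
  s_zero : ∀ A X : C, s (0 : Ext E X A) = seqClass (biprod.inl : A ⟶ A ⊞ X) biprod.snd
  s_sum : ∀ {A B X A' B' X' : C} (x : A ⟶ B) (y : B ⟶ X) (δ : Ext E X A)
    (x' : A' ⟶ B') (y' : B' ⟶ X') (δ' : Ext E X' A'),
    s δ = seqClass x y → s δ' = seqClass x' y' →
      s (extSum E δ δ') = seqClass (biprod.map x x') (biprod.map y y')
  et3 : ∀ {A B X A' B' X' : C} (x : A ⟶ B) (y : B ⟶ X) (δ : Ext E X A)
    (x' : A' ⟶ B') (y' : B' ⟶ X') (δ' : Ext E X' A'),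
    s δ = seqClass x y → s δ' = seqClass x' y' →
    ∀ (a : A ⟶ A') (b : B ⟶ B'), x ≫ b = a ≫ x' →
      ∃ c : X ⟶ X', push E a δ = pull E c δ' ∧ y ≫ c = b ≫ y'
  et3_op : ∀ {A B X A' B' X' : C} (x : A ⟶ B) (y : B ⟶ X) (δ : Ext E X A)
    (x' : A' ⟶ B') (y' : B' ⟶ X') (δ' : Ext E X' A'),
    s δ = seqClass x y → s δ' = seqClass x' y' →
    ∀ (b : B ⟶ B') (c : X ⟶ X'), y ≫ c = b ≫ y' →
      ∃ a : A ⟶ A', push E a δ = pull E c δ' ∧ x ≫ b = a ≫ x'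
  et4 : ∀ {A B D X F : C} (f : A ⟶ B) (f' : B ⟶ D) (δ : Ext E D A)
    (g : B ⟶ X) (g' : X ⟶ F) (δ' : Ext E F B),
    s δ = seqClass f f' → s δ' = seqClass g g' →
    ∃ (G : C) (h : A ⟶ X) (h' : X ⟶ G) (d : D ⟶ G) (e : G ⟶ F) (δ'' : Ext E G A),
      f ≫ g = h ∧ f' ≫ d = g ≫ h' ∧ h' ≫ e = g' ∧
      s δ'' = seqClass h h' ∧
      s (push E f' δ') = seqClass d e ∧
      pull E d δ'' = δ ∧
      push E f δ'' = pull E e δ'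
  et4_op : ∀ {A B D X F : C} (f' : D ⟶ B) (f : B ⟶ A) (δ : Ext E A D)
    (g' : F ⟶ X) (g : X ⟶ B) (δ' : Ext E B F),
    s δ = seqClass f' f → s δ' = seqClass g' g →
    ∃ (G : C) (h' : G ⟶ X) (h : X ⟶ A) (e : F ⟶ G) (d : G ⟶ D) (δ'' : Ext E A G),
      g ≫ f = h ∧ d ≫ f' = h' ≫ g ∧ e ≫ h' = g' ∧
      s δ'' = seqClass h' h ∧
      s (pull E f' δ') = seqClass e d ∧
      push E d δ'' = δ ∧
      pull E f δ'' = push E e δ'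

/-- A Krull-Schmidt category: every object is a finite direct sum of objects with local
endomorphism rings. -/
def IsKrullSchmidt (C : Type u) [Category.{v} C] [Preadditive C]
    [HasFiniteBiproducts C] : Prop :=
  ∀ X : C, ∃ (n : ℕ) (Y : Fin n → C), (∀ i, IsLocalRing (End (Y i))) ∧ Nonempty (X ≅ ⨁ Y)

/-- A "subcategory": full, additive, closed under isomorphisms and direct summands. -/
structure IsAdditiveSubcategory {C : Type u} [Category.{v} C] [Preadditive C]
    [HasFiniteBiproducts C] [HasBinaryBiproducts C] (ω : ObjectProperty C) : Prop where
  of_iso : ∀ {X Y : C}, (X ≅ Y) → ω X → ω Y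
  of_isZero : ∀ {Z : C}, IsZero Z → ω Z
  biprod : ∀ {X Y : C}, ω X → ω Y → ω (X ⊞ Y)
  of_biprod : ∀ {X Y : C}, ω (X ⊞ Y) → ω X

namespace ExtriangulatedStructure

variable {C : Type u} [Category.{v} C] [Preadditive C]
  [HasFiniteBiproducts C] [HasBinaryBiproducts C]
variable (𝓔 : ExtriangulatedStructure.{w} C)

/-- `A ⟶ B ⟶ X ⇢` (with extension `δ`) is an `𝔼`-triangle. -/
def IsETriangle {A B X : C} (x : A ⟶ B) (y : B ⟶ X) (δ : Ext 𝓔.E X A) : Prop :=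
  𝓔.s δ = seqClass x y

def IsProj (P : C) : Prop :=
  ∀ {A B X : C} (x : A ⟶ B) (y : B ⟶ X) (δ : Ext 𝓔.E X A), 𝓔.IsETriangle x y δ →
    ∀ c : P ⟶ X, ∃ b : P ⟶ B, b ≫ y = c

def IsInj (I : C) : Prop :=
  ∀ {A B X : C} (x : A ⟶ B) (y : B ⟶ X) (δ : Ext 𝓔.E X A), 𝓔.IsETriangle x y δ →
    ∀ a : A ⟶ I, ∃ b : B ⟶ I, x ≫ b = a

class HasEnoughProj : Prop where
  exists_triangle : ∀ X : C, ∃ (A P : C) (x : A ⟶ P) (y : P ⟶ X) (δ : Ext 𝓔.E X A),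
    𝓔.IsETriangle x y δ ∧ 𝓔.IsProj P

class HasEnoughInj : Prop where
  exists_triangle : ∀ A : C, ∃ (I X : C) (x : A ⟶ I) (y : I ⟶ X) (δ : Ext 𝓔.E X A),
    𝓔.IsETriangle x y δ ∧ 𝓔.IsInj I

/-- A (chosen) syzygy `Ω X`. -/
noncomputable def syzygy [𝓔.HasEnoughProj] (X : C) : C :=
  (HasEnoughProj.exists_triangle (𝓔 := 𝓔) X).choose

/-- The higher extension group `𝔼^{i+1}(X, Y) = 𝔼(Ωⁱ X, Y)`; up to isomorphism it does not depend
on the choice of the syzygies. -/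
abbrev HigherExt [𝓔.HasEnoughProj] (i : ℕ) (X Y : C) : Type w :=
  Ext 𝓔.E (𝓔.syzygy^[i] X) Y

/-- `ω^⊥`: the objects `Y` with `𝔼^i(X, Y) = 0` for all `i ≥ 1` and all `X ∈ ω`. -/
def rightPerp [𝓔.HasEnoughProj] (ω : ObjectProperty C) : ObjectProperty C :=
  fun Y => ∀ X, ω X → ∀ i : ℕ, ∀ δ : 𝓔.HigherExt i X Y, δ = 0

/-- `ω ⊥ ω`. -/
def IsSelfOrthogonal [𝓔.HasEnoughProj] (ω : ObjectProperty C) : Prop :=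
  ω ≤ 𝓔.rightPerp ω

/-- `ω̂_n`: the objects `A` with an `𝔼`-triangle sequence `W_n ⟶ ⋯ ⟶ W_0 ⟶ A` with `W_i ∈ ω`,
that is, with `𝔼`-triangles `K_{i+1} ⟶ W_i ⟶ K_i ⇢` for `i < n`, where `K_0 = A` and
`K_n = W_n`. -/
def hatN (ω : ObjectProperty C) : ℕ → ObjectProperty C
  | 0 => ω
  | n + 1 => fun A => ∃ (K W : C) (x : K ⟶ W) (y : W ⟶ A) (δ : Ext 𝓔.E A K),
      𝓔.IsETriangle x y δ ∧ ω W ∧ hatN ω n K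

/-- `ω̂`, the union of all `ω̂_n`. -/
def hat (ω : ObjectProperty C) : ObjectProperty C := fun A => ∃ n, 𝓔.hatN ω n A

/-- `ω̌_n`: the objects `A` with an `𝔼`-triangle sequence `A ⟶ W^0 ⟶ ⋯ ⟶ W^n` with `W^i ∈ ω`,
that is, with `𝔼`-triangles `K^i ⟶ W^i ⟶ K^{i+1} ⇢` for `i < n`, where `K^0 = A` and
`K^n = W^n`. -/
def checkN (ω : ObjectProperty C) : ℕ → ObjectProperty C
  | 0 => ω
  | n + 1 => fun A => ∃ (W K : C) (x : A ⟶ W) (y : W ⟶ K) (δ : Ext 𝓔.E K A),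
      𝓔.IsETriangle x y δ ∧ ω W ∧ checkN ω n K

/-- `ω̌`, the union of all `ω̌_n`. -/
def check (ω : ObjectProperty C) : ObjectProperty C := fun A => ∃ n, 𝓔.checkN ω n A

/-- `ω̃`, that is, `ˇ` applied to `ω̂`. -/
def tilde (ω : ObjectProperty C) : ObjectProperty C := 𝓔.check (𝓔.hat ω)

/-- An infinite `𝔼`-triangle sequence `⋯ ⟶ W_2 ⟶ W_1 ⟶ W_0 ⟶ A`, glued from `𝔼`-triangles
`K_{i+1} ⟶ W_i ⟶ K_i ⇢` with `K_0 ≅ A`; its differentials are the composites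
`W_{i+1} ⟶ K_{i+1} ⟶ W_i` and `W_0 ⟶ K_0 ≅ A`. -/
structure LeftSequence (A : C) where
  W : ℕ → C
  K : ℕ → C
  g : ∀ i, K (i + 1) ⟶ W i
  f : ∀ i, W i ⟶ K i
  δ : ∀ i, Ext 𝓔.E (K i) (K (i + 1))
  isETriangle : ∀ i, 𝓔.IsETriangle (g i) (f i) (δ i)
  augmentation : K 0 ≅ A

/-- `_ω𝒳`: the objects `A` with an `𝔼`-triangle sequence `⋯ ⟶ W_1 ⟶ W_0 ⟶ A` such that each
`W_i ∈ ω` and each `K_i ∈ ω^⊥`. -/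
def leftX [𝓔.HasEnoughProj] (ω : ObjectProperty C) : ObjectProperty C :=
  fun A => ∃ R : 𝓔.LeftSequence A, (∀ i, ω (R.W i)) ∧ ∀ i, 𝓔.rightPerp ω (R.K i)

end ExtriangulatedStructure

end Extri

/-! Both equivalences are one statement, `check_tfae`, about a class `Y ⊇ ω` that is closed under
extensions, contains the cones of inflations from `Y` to `ω`, and whose objects are each covered by
an object of `ω` with cocone in `Y`. From 3 to 2, cover `U'` by `W ∈ ω` and apply (ET4)ᵒᵖ; from 2 to
3, embed `V` in an object of `ω` and apply (ET4). From 1 to 3, induct on the length of the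
coresolution: given `M ⟶ Y₀ ⟶ K`, approximate `K` by `U ⟶ V ⟶ K` and form the pullback `P`, an
extension of `Y₀` by `U` with `M ⟶ P ⟶ V`. From 3 to 1 is immediate from `ω ≤ Y`. For `hat ω` and
`leftX ω` the real hypothesis is extension closure, a horseshoe argument that works because both
classes lie in `ω^⊥`. The two general inputs are the pullback of triangles with a common third term
and dimension shifting along syzygies. -/

namespace Extri

/-! ### Functoriality of `𝔼` and equivalence of sequences -/

section Bifunctor

variable {C : Type u} [Category.{v} C] (E : Cᵒᵖ ⥤ C ⥤ AddCommGrpCat.{w})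

lemma push_id {X A : C} (δ : Ext E X A) : push E (𝟙 A) δ = δ := by simp [push]

lemma pull_id {X A : C} (δ : Ext E X A) : pull E (𝟙 X) δ = δ := by simp [pull]

lemma push_comp {X A A' A'' : C} (a : A ⟶ A') (b : A' ⟶ A'') (δ : Ext E X A) :
    push E (a ≫ b) δ = push E b (push E a δ) := by simp [push]

lemma pull_comp {X X' X'' A : C} (c : X' ⟶ X) (d : X'' ⟶ X') (δ : Ext E X A) :
    pull E (d ≫ c) δ = pull E d (pull E c δ) := by simp [pull]

lemma push_pull {X X' A A' : C} (a : A ⟶ A') (c : X' ⟶ X) (δ : Ext E X A) :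
    push E a (pull E c δ) = pull E c (push E a δ) := by
  have h := (E.map c.op).naturality a
  exact (ConcreteCategory.congr_hom h δ).symm

lemma push_map_add {X A A' : C} (a : A ⟶ A') (δ ε : Ext E X A) :
    push E a (δ + ε) = push E a δ + push E a ε := map_add _ _ _

lemma push_map_zero {X A A' : C} (a : A ⟶ A') : push E a (0 : Ext E X A) = 0 := map_zero _

lemma pull_map_sub {X X' A : C} (c : X' ⟶ X) (δ ε : Ext E X A) :
    pull E c (δ - ε) = pull E c δ - pull E c ε := map_sub _ _ _

lemma seqClass_eq_of_iso {A B B' X : C} {x : A ⟶ B} {y : B ⟶ X} {x' : A ⟶ B'} {y' : B' ⟶ X}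
    (b : B ≅ B') (hx : x ≫ b.hom = x') (hy : b.hom ≫ y' = y) : seqClass x y = seqClass x' y' :=
  Quotient.sound ⟨b, hx, hy⟩

lemma exists_iso_of_seqClass_eq {A B B' X : C} {x : A ⟶ B} {y : B ⟶ X} {x' : A ⟶ B'} {y' : B' ⟶ X}
    (h : seqClass x y = seqClass x' y') : ∃ b : B ≅ B', x ≫ b.hom = x' ∧ b.hom ≫ y' = y :=
  Quotient.exact h

end Bifunctor

/-! ### Additivity and split triangles -/

namespace ExtriangulatedStructure

variable {C : Type u} [Category.{v} C] [Preadditive C]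
  [HasFiniteBiproducts C] [HasBinaryBiproducts C]
variable (𝓔 : ExtriangulatedStructure.{w} C)

lemma push_zero {X A A' : C} (δ : Ext 𝓔.E X A) : push 𝓔.E (0 : A ⟶ A') δ = 0 := by
  have h := 𝓔.push_add (0 : A ⟶ A') 0 δ
  simpa using h

lemma push_neg {X A A' : C} (a : A ⟶ A') (δ : Ext 𝓔.E X A) :
    push 𝓔.E (-a) δ = -push 𝓔.E a δ := by
  have h := 𝓔.push_add (-a) a δ
  rw [neg_add_cancel, push_zero] at h
  exact eq_neg_of_add_eq_zero_left h.symm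

lemma exists_realization {X A : C} (δ : Ext 𝓔.E X A) :
    ∃ (B : C) (x : A ⟶ B) (y : B ⟶ X), 𝓔.IsETriangle x y δ := by
  obtain ⟨S, hS⟩ := Quotient.exists_rep (𝓔.s δ)
  exact ⟨S.B, S.x, S.y, hS.symm⟩

lemma isETriangle_zero (A X : C) :
    𝓔.IsETriangle (biprod.inl : A ⟶ A ⊞ X) biprod.snd 0 := 𝓔.s_zero A X

lemma isETriangle_id_right (A : C) {Z : C} (hZ : IsZero Z) :
    𝓔.IsETriangle (𝟙 A) (0 : A ⟶ Z) 0 :=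
  (𝓔.s_zero A Z).trans (seqClass_eq_of_iso (isoBiprodZero hZ).symm
    (by simp) (hZ.eq_of_tgt _ _))

lemma isETriangle_id_left {Z : C} (hZ : IsZero Z) (A : C) :
    𝓔.IsETriangle (0 : Z ⟶ A) (𝟙 A) 0 :=
  (𝓔.s_zero Z A).trans (seqClass_eq_of_iso (isoZeroBiprod hZ).symm
    (hZ.eq_of_src _ _) (by simp))

variable {𝓔}

/-! ### Exactness properties, end isomorphisms and pullbacks -/

namespace IsETriangle

lemma of_middle_iso {A B B' X : C} {x : A ⟶ B} {y : B ⟶ X} {δ : Ext 𝓔.E X A}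
    (h : 𝓔.IsETriangle x y δ) (b : B ≅ B') : 𝓔.IsETriangle (x ≫ b.hom) (b.inv ≫ y) δ :=
  Eq.trans h (seqClass_eq_of_iso b rfl (by simp))

variable {A B X : C} {x : A ⟶ B} {y : B ⟶ X} {δ : Ext 𝓔.E X A}

/-- (ET3) into the split triangle `0 ⟶ T ⟶ T`. -/
lemma exists_desc (h : 𝓔.IsETriangle x y δ) {T : C} (t : B ⟶ T) (ht : x ≫ t = 0) :
    ∃ s : X ⟶ T, y ≫ s = t := by
  obtain ⟨Z, hZ⟩ := HasZeroObject.zero (C := C)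
  obtain ⟨c, -, hc⟩ := 𝓔.et3 x y δ _ _ _ h (𝓔.isETriangle_id_left hZ T) 0 t (by simp [ht])
  exact ⟨c, by simpa using hc⟩

lemma exists_lift (h : 𝓔.IsETriangle x y δ) {T : C} (t : T ⟶ X) (ht : pull 𝓔.E t δ = 0) :
    ∃ s : T ⟶ B, s ≫ y = t := by
  obtain ⟨b, -, hb⟩ := 𝓔.realize_hom _ _ _ x y δ (𝓔.isETriangle_zero A T) h (𝟙 A) t
    (by rw [push_id, ht])
  exact ⟨biprod.inr ≫ b, by rw [Category.assoc, ← hb]; simp⟩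

lemma exists_push_of_comp_eq (h : 𝓔.IsETriangle x y δ) {A' B' : C} {x' : A' ⟶ B'} {y' : B' ⟶ X}
    {δ' : Ext 𝓔.E X A'} (h' : 𝓔.IsETriangle x' y' δ') (b : B ⟶ B') (hb : b ≫ y' = y) :
    ∃ a : A ⟶ A', push 𝓔.E a δ = δ' := by
  obtain ⟨a, ha, -⟩ := 𝓔.et3_op x y δ x' y' δ' h h' b (𝟙 X) (by simp [hb])
  exact ⟨a, by rw [ha, pull_id]⟩

lemma exists_push_of_pull_eq_zero (h : 𝓔.IsETriangle x y δ) {T : C} (ε : Ext 𝓔.E X T)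
    (hε : pull 𝓔.E y ε = 0) : ∃ a : A ⟶ T, push 𝓔.E a δ = ε := by
  obtain ⟨B', x', y', h'⟩ := 𝓔.exists_realization ε
  obtain ⟨b, hb⟩ := h'.exists_lift y hε
  exact h.exists_push_of_comp_eq h' b hb

/-- Exactness of `𝔼(T, A) ⟶ 𝔼(T, B) ⟶ 𝔼(T, X)`. By (ET4), `y_* ε` is realized by the sequence of
cones `X ⟶ G ⟶ T`; it splits, and pulling `δ''` back along a section gives the preimage. -/
lemma exists_push_of_push_eq_zero (h : 𝓔.IsETriangle x y δ) {T : C} (ε : Ext 𝓔.E T B)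
    (hε : push 𝓔.E y ε = 0) : ∃ ε' : Ext 𝓔.E T A, push 𝓔.E x ε' = ε := by
  obtain ⟨F, g, g', hg⟩ := 𝓔.exists_realization ε
  obtain ⟨G, k, k', d, e, δ'', -, -, -, -, hde, hd, hpush⟩ := 𝓔.et4 x y δ g g' ε h hg
  rw [hε] at hde
  obtain ⟨b, -, hb⟩ := exists_iso_of_seqClass_eq ((𝓔.s_zero X T).symm.trans hde)
  refine ⟨pull 𝓔.E (biprod.inr ≫ b.hom) δ'', ?_⟩
  rw [push_pull, hpush, ← pull_comp, Category.assoc, hb]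
  simp [pull_id]

/-- `𝔼`-triangles are closed under isomorphisms of the end terms. -/
lemma of_end_iso (h : 𝓔.IsETriangle x y δ) {A' X' : C} (a : A ≅ A') (c : X ≅ X') :
    𝓔.IsETriangle (a.inv ≫ x) (y ≫ c.hom) (push 𝓔.E a.hom (pull 𝓔.E c.inv δ)) := by
  set ε := push 𝓔.E a.hom (pull 𝓔.E c.inv δ) with hε
  obtain ⟨B', x', y', h'⟩ := 𝓔.exists_realization ε
  have e₁ : push 𝓔.E a.hom δ = pull 𝓔.E c.hom ε := by
    rw [hε, ← push_pull, ← pull_comp, c.hom_inv_id, pull_id]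
  have e₂ : push 𝓔.E a.inv ε = pull 𝓔.E c.inv δ := by
    rw [hε, ← push_comp, a.hom_inv_id, push_id]
  obtain ⟨b, hb, hb'⟩ := 𝓔.realize_hom _ _ _ _ _ _ h h' _ _ e₁
  obtain ⟨d, hd, hd'⟩ := 𝓔.realize_hom _ _ _ _ _ _ h' h _ _ e₂
  -- An endomorphism `t` of the middle term fixing both ends has `(t - 𝟙)² = 0`, so `2 - t` inverts
  -- it.
  have key : ∀ {P Q R : C} {p : P ⟶ Q} {q : Q ⟶ R} {η : Ext 𝓔.E R P}, 𝓔.IsETriangle p q η →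
      ∀ t : Q ⟶ Q, p ≫ t = p → t ≫ q = q → IsIso t := by
    intro P Q R p q η hη t h₁ h₂
    obtain ⟨s, hs⟩ := hη.exists_desc (t - 𝟙 Q) (by simp [h₁])
    have hsq : (t - 𝟙 Q) ≫ (t - 𝟙 Q) = 0 := by
      nth_rw 2 [← hs]
      rw [← Category.assoc]
      simp [h₂]
    have h₃ : t ≫ t - t - (t - 𝟙 Q) = 0 := by simpa using hsq
    have h₄ : t ≫ t = t + t - 𝟙 Q := by
      rw [← sub_eq_zero, ← h₃]; abel
    exact ⟨𝟙 Q + 𝟙 Q - t, by simp [h₄], by simp [h₄]⟩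
  have i₁ : IsIso (b ≫ d) := key h _
    (by rw [← Category.assoc, hb, Category.assoc, hd, ← Category.assoc, a.hom_inv_id,
      Category.id_comp])
    (by rw [Category.assoc, ← hd', ← Category.assoc, ← hb', Category.assoc, c.hom_inv_id,
      Category.comp_id])
  have i₂ : IsIso (d ≫ b) := key h' _
    (by rw [← Category.assoc, hd, Category.assoc, hb, ← Category.assoc, a.inv_hom_id,
      Category.id_comp])
    (by rw [Category.assoc, ← hb', ← Category.assoc, ← hd', Category.assoc, c.inv_hom_id,
      Category.comp_id])
  have m₁ : Mono b := mono_of_mono b d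
  have s₁ : IsSplitEpi b := ⟨⟨⟨inv (d ≫ b) ≫ d, by simp⟩⟩⟩
  have i : IsIso b := isIso_of_mono_of_isSplitEpi b
  refine Eq.trans h' (seqClass_eq_of_iso (asIso b) ?_ ?_).symm
  · simp [hb]
  · simp [hb']

/-- The shifted triangles of two `𝔼`-triangles with a common third term. -/
lemma exists_pullback (h : 𝓔.IsETriangle x y δ) {A' B' : C} {x' : A' ⟶ B'} {y' : B' ⟶ X}
    {δ' : Ext 𝓔.E X A'} (h' : 𝓔.IsETriangle x' y' δ') :
    ∃ (P : C) (p : A ⟶ P) (q : P ⟶ B') (p' : A' ⟶ P) (q' : P ⟶ B) (ε : Ext 𝓔.E B' A)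
      (ε' : Ext 𝓔.E B A'), 𝓔.IsETriangle p q ε ∧ 𝓔.IsETriangle p' q' ε' := by
  obtain ⟨P, p', q', hP⟩ := 𝓔.exists_realization (pull 𝓔.E y δ')
  obtain ⟨G, k, k', e, d, δ'', -, -, -, hG, hed, hd, hpull⟩ := 𝓔.et4_op x y δ p' q' _ h hP
  have hxy : pull 𝓔.E x (pull 𝓔.E y δ') = 0 := by
    obtain ⟨Z, hZ⟩ := HasZeroObject.zero (C := C)
    obtain ⟨c, -, hc⟩ := 𝓔.et3 _ _ _ x y δ (𝓔.isETriangle_id_right A hZ) h (𝟙 A) x (by simp)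
    rw [← pull_comp, ← hc, zero_comp]
    have := 𝓔.pull_add (0 : A ⟶ X) 0 δ'
    simpa using this
  rw [hxy] at hed
  obtain ⟨b, hb, hb'⟩ := exists_iso_of_seqClass_eq ((𝓔.s_zero A' A).symm.trans hed)
  obtain ⟨t, ht⟩ := h.exists_push_of_pull_eq_zero (δ'' - push 𝓔.E e δ')
    (by rw [pull_map_sub, hpull, push_pull, sub_self])
  have ht' : δ'' = push 𝓔.E t δ + push 𝓔.E e δ' := by rw [ht, sub_add_cancel]
  -- The obvious retraction `G ⟶ A'` sends `δ''` to `δ'` plus an error pushed from `δ` along `t`;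
  -- since `d_* δ'' = δ`, adding `d ≫ u` cancels the error.
  set u : A ⟶ A' := -(t ≫ b.inv ≫ biprod.fst) with hu
  have he : e ≫ b.inv = biprod.inl := by rw [← hb]; simp
  have hr : push 𝓔.E (b.inv ≫ (biprod.fst + biprod.snd ≫ u)) δ'' = δ' := by
    have e₁ : b.inv ≫ (biprod.fst + biprod.snd ≫ u) = b.inv ≫ biprod.fst + d ≫ u := by
      rw [← hb']; simp
    rw [e₁, 𝓔.push_add, push_comp _ d, hd, hu, push_neg]
    conv_lhs => rw [ht']
    rw [push_map_add, ← push_comp, ← push_comp, ← Category.assoc e, he]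
    simp [push_id]
  let φ : A ⊞ A' ≅ A' ⊞ A :=
    { hom := biprod.desc (biprod.lift (-u) (𝟙 A)) biprod.inl
      inv := biprod.lift biprod.snd (biprod.fst + biprod.snd ≫ u)
      hom_inv_id := by ext <;> simp
      inv_hom_id := by ext <;> simp }
  have hs := (𝓔.isETriangle_zero A A').of_middle_iso (φ ≪≫ b)
  have hsnd : (φ ≪≫ b).inv ≫ biprod.snd = b.inv ≫ (biprod.fst + biprod.snd ≫ u) := by
    simp [φ]
  rw [hsnd] at hs
  -- Here `A ⟶ G ⟶ A'` is split with the corrected retraction, so the cone `Q` of `A ⟶ P` sits in a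
  -- realization of `δ'`, whence `Q ≅ B'`.
  obtain ⟨Q, m, m', n, n', η, -, -, -, hm, hn, -, -⟩ := 𝓔.et4 _ _ _ k k' δ'' hs hG
  rw [hr] at hn
  obtain ⟨c, -, -⟩ := exists_iso_of_seqClass_eq (hn.symm.trans h')
  exact ⟨P, _, _, p', q', _, _, IsETriangle.of_end_iso hm (Iso.refl A) c, hP⟩

end IsETriangle

/-! ### The class `ω^⊥` and the horseshoe -/

section Perp

variable [𝓔.HasEnoughProj] {ω : ObjectProperty C}

lemma exists_syzygy_triangle (Z : C) : ∃ (P : C) (x : 𝓔.syzygy Z ⟶ P) (y : P ⟶ Z)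
    (δ : Ext 𝓔.E Z (𝓔.syzygy Z)), 𝓔.IsETriangle x y δ ∧ 𝓔.IsProj P :=
  (HasEnoughProj.exists_triangle (𝓔 := 𝓔) Z).choose_spec

lemma rightPerp.ext_eq_zero {X Y : C} (hY : 𝓔.rightPerp ω Y) (hX : ω X) (δ : Ext 𝓔.E X Y) :
    δ = 0 := hY X hX 0 δ

/-- Dimension shift in the first variable: a class in `𝔼(Ωⁱ T, X)` is pushed from the syzygy
triangle along `Ωⁱ⁺¹ T ⟶ X`, which lifts to `B` because `𝔼(Ωⁱ⁺¹ T, A) = 0`. The class thus comes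
from `𝔼(Ωⁱ T, B) = 0`. -/
lemma rightPerp.of_cone {A B X : C} {x : A ⟶ B} {y : B ⟶ X} {δ : Ext 𝓔.E X A}
    (h : 𝓔.IsETriangle x y δ) (hA : 𝓔.rightPerp ω A) (hB : 𝓔.rightPerp ω B) :
    𝓔.rightPerp ω X := by
  intro T hT i ε
  obtain ⟨P, p, q, η, hη, hP⟩ := exists_syzygy_triangle (𝓔 := 𝓔) (𝓔.syzygy^[i] T)
  obtain ⟨F, g, g', hg⟩ := 𝓔.exists_realization ε
  obtain ⟨b, hb⟩ := hP g g' ε hg q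
  obtain ⟨a, rfl⟩ := hη.exists_push_of_comp_eq hg b hb
  have hA' : ∀ ζ : Ext 𝓔.E (𝓔.syzygy (𝓔.syzygy^[i] T)) A, ζ = 0 := by
    rw [← Function.iterate_succ_apply' 𝓔.syzygy i T]
    exact hA T hT (i + 1)
  obtain ⟨c, rfl⟩ := h.exists_lift a (hA' _)
  rw [push_comp, hB T hT i (push 𝓔.E c η), push_map_zero]

lemma rightPerp.of_extension {A B X : C} {x : A ⟶ B} {y : B ⟶ X} {δ : Ext 𝓔.E X A}
    (h : 𝓔.IsETriangle x y δ) (hA : 𝓔.rightPerp ω A) (hX : 𝓔.rightPerp ω X) :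
    𝓔.rightPerp ω B := by
  intro T hT i ε
  obtain ⟨ε', rfl⟩ := h.exists_push_of_push_eq_zero ε (hX T hT i _)
  rw [hA T hT i ε', push_map_zero]

lemma rightPerp.of_iso {X Y : C} (e : X ≅ Y) (hX : 𝓔.rightPerp ω X) : 𝓔.rightPerp ω Y := by
  intro T hT i ε
  have h₁ : ε = push 𝓔.E e.hom (push 𝓔.E e.inv ε) := by
    rw [← push_comp, e.inv_hom_id, push_id]
  rw [h₁, hX T hT i (push 𝓔.E e.inv ε), push_map_zero]

/-- The horseshoe construction: one step of an `ω`-resolution of an extension. -/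
lemma exists_horseshoe (hω : IsAdditiveSubcategory ω) {X B Z K W K' W' : C}
    {x : X ⟶ B} {y : B ⟶ Z} {δ : Ext 𝓔.E Z X} (h : 𝓔.IsETriangle x y δ)
    (hX : 𝓔.rightPerp ω X)
    {k : K ⟶ W} {p : W ⟶ Z} {η : Ext 𝓔.E Z K} (hη : 𝓔.IsETriangle k p η) (hW : ω W)
    {k' : K' ⟶ W'} {p' : W' ⟶ X} {η' : Ext 𝓔.E X K'} (hη' : 𝓔.IsETriangle k' p' η')
    (hW' : ω W') :
    ∃ (G W₀ : C) (a : G ⟶ W₀) (b : W₀ ⟶ B) (ε : Ext 𝓔.E B G) (c : K' ⟶ G) (d : G ⟶ K)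
      (ζ : Ext 𝓔.E K K'), 𝓔.IsETriangle a b ε ∧ ω W₀ ∧ 𝓔.IsETriangle c d ζ := by
  obtain ⟨F, r, q, r', q', ε, ε', hF, hF'⟩ := h.exists_pullback hη
  -- Since `𝔼(W, X) = 0`, the pullback is `X ⊞ W`, which `W' ⊞ W` covers with cocone `K' ⊞ 0 ≅ K'`.
  rw [hX.ext_eq_zero hW ε] at hF
  obtain ⟨φ, -, -⟩ := exists_iso_of_seqClass_eq (Eq.trans (Eq.symm hF) (𝓔.s_zero X W))
  obtain ⟨O, hO⟩ := HasZeroObject.zero (C := C)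
  have hsum := IsETriangle.of_end_iso (𝓔 := 𝓔)
    (𝓔.s_sum _ _ _ _ _ _ hη' (𝓔.isETriangle_id_left hO W)) (isoBiprodZero hO).symm (Iso.refl _)
  obtain ⟨G, a, b, c, d, ζ, -, -, -, h₁, h₂, -, -⟩ :=
    𝓔.et4_op _ _ _ _ _ _ (hF'.of_middle_iso φ) hsum
  exact ⟨G, _, a, b, ζ, c, d, _, h₁, hω.biprod hW' hW, h₂⟩

end Perp

/-! ### Infinite resolutions: closure properties of `leftX ω` -/

section LeftX

variable [𝓔.HasEnoughProj] {ω : ObjectProperty C}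

lemma leftX.le_rightPerp : 𝓔.leftX ω ≤ 𝓔.rightPerp ω := by
  rintro A ⟨R, -, hK⟩
  exact rightPerp.of_iso R.augmentation (hK 0)

lemma leftX.exists_triangle {A : C} (hA : 𝓔.leftX ω A) :
    ∃ (K W : C) (x : K ⟶ W) (y : W ⟶ A) (δ : Ext 𝓔.E A K),
      𝓔.IsETriangle x y δ ∧ ω W ∧ 𝓔.leftX ω K := by
  obtain ⟨R, hW, hK⟩ := hA
  exact ⟨_, _, _, _, _, (R.isETriangle 0).of_end_iso (Iso.refl _) R.augmentation, hW 0,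
    ⟨fun i => R.W (i + 1), fun i => R.K (i + 1), fun i => R.g (i + 1), fun i => R.f (i + 1),
      fun i => R.δ (i + 1), fun i => R.isETriangle (i + 1), Iso.refl _⟩,
    fun i => hW (i + 1), fun i => hK (i + 1)⟩

/-- The coinduction principle for `_ω𝒳`. -/
lemma le_leftX_of_exists_triangle {P : ObjectProperty C} (hP : P ≤ 𝓔.rightPerp ω)
    (H : ∀ A, P A → ∃ (K W : C) (x : K ⟶ W) (y : W ⟶ A) (δ : Ext 𝓔.E A K),
      𝓔.IsETriangle x y δ ∧ ω W ∧ P K) : P ≤ 𝓔.leftX ω := by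
  choose K W x y δ h hW hK using H
  intro A hA
  let S : ℕ → {A : C // P A} := fun n =>
    Nat.rec ⟨A, hA⟩ (fun _ T => ⟨K T.1 T.2, hK T.1 T.2⟩) n
  exact ⟨⟨fun i => W (S i).1 (S i).2, fun i => (S i).1, fun i => x (S i).1 (S i).2,
    fun i => y (S i).1 (S i).2, fun i => δ (S i).1 (S i).2, fun i => h (S i).1 (S i).2,
    Iso.refl _⟩, fun i => hW _ _, fun i => hP _ (S i).2⟩

lemma le_leftX (hω : IsAdditiveSubcategory ω) (hself : 𝓔.IsSelfOrthogonal ω) :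
    ω ≤ 𝓔.leftX ω := by
  refine le_leftX_of_exists_triangle hself fun A hA => ?_
  obtain ⟨O, hO⟩ := HasZeroObject.zero (C := C)
  exact ⟨_, _, _, _, _, 𝓔.isETriangle_id_left hO A, hA, hω.of_isZero hO⟩

lemma leftX.of_cone (hself : 𝓔.IsSelfOrthogonal ω) {U W G : C} {x : U ⟶ W} {y : W ⟶ G}
    {δ : Ext 𝓔.E G U} (h : 𝓔.IsETriangle x y δ) (hU : 𝓔.leftX ω U) (hW : ω W) :
    𝓔.leftX ω G := by
  -- Adjoining `G` alone suffices: its given triangle leads straight back into `leftX ω`.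
  refine le_leftX_of_exists_triangle (P := fun A => 𝓔.leftX ω A ∨ A = G) ?_ ?_ G (Or.inr rfl)
  · rintro A (hA | rfl)
    · exact leftX.le_rightPerp A hA
    · exact rightPerp.of_cone h (leftX.le_rightPerp U hU) (hself W hW)
  · rintro A (hA | rfl)
    · obtain ⟨K, W', a, b, ε, h₁, h₂, h₃⟩ := hA.exists_triangle
      exact ⟨K, W', a, b, ε, h₁, h₂, Or.inl h₃⟩
    · exact ⟨U, W, x, y, δ, h, hW, Or.inl hU⟩

lemma leftX.of_extension (hω : IsAdditiveSubcategory ω) {X B Z : C} {x : X ⟶ B} {y : B ⟶ Z}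
    {δ : Ext 𝓔.E Z X} (h : 𝓔.IsETriangle x y δ) (hX : 𝓔.leftX ω X) (hZ : 𝓔.leftX ω Z) :
    𝓔.leftX ω B := by
  -- The class of all such extensions is coinductive, as the horseshoe returns another extension of
  -- the same kind.
  refine le_leftX_of_exists_triangle (P := fun B => ∃ (X Z : C) (x : X ⟶ B) (y : B ⟶ Z)
    (δ : Ext 𝓔.E Z X), 𝓔.IsETriangle x y δ ∧ 𝓔.leftX ω X ∧ 𝓔.leftX ω Z) ?_ ?_ B
    ⟨X, Z, x, y, δ, h, hX, hZ⟩
  · rintro B ⟨X, Z, x, y, δ, h, hX, hZ⟩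
    exact rightPerp.of_extension h (leftX.le_rightPerp X hX) (leftX.le_rightPerp Z hZ)
  · rintro B ⟨X, Z, x, y, δ, h, hX, hZ⟩
    obtain ⟨K, W, k, p, η, hη, hW, hK⟩ := hZ.exists_triangle
    obtain ⟨K', W', k', p', η', hη', hW', hK'⟩ := hX.exists_triangle
    obtain ⟨G, W₀, a, b, ε, c, d, ζ, h₁, h₂, h₃⟩ :=
      exists_horseshoe hω h (leftX.le_rightPerp X hX) hη hW hη' hW'
    exact ⟨G, W₀, a, b, ε, h₁, h₂, K', K, c, d, ζ, h₃, hK', hK⟩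

end LeftX

/-! ### Finite resolutions: closure properties of `hat ω` -/

section Hat

variable {ω : ObjectProperty C}

lemma hatN_le_succ (hω : IsAdditiveSubcategory ω) : ∀ n, 𝓔.hatN ω n ≤ 𝓔.hatN ω (n + 1)
  | 0, A, hA => by
    obtain ⟨O, hO⟩ := HasZeroObject.zero (C := C)
    exact ⟨_, _, _, _, _, 𝓔.isETriangle_id_left hO A, hA, hω.of_isZero hO⟩
  | n + 1, _, ⟨K, W, x, y, δ, h, hW, hK⟩ =>
    ⟨K, W, x, y, δ, h, hW, hatN_le_succ hω n K hK⟩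

lemma hatN_mono (hω : IsAdditiveSubcategory ω) : Monotone (𝓔.hatN ω) :=
  monotone_nat_of_le_succ (hatN_le_succ hω)

lemma hat.exists_triangle (hω : IsAdditiveSubcategory ω) {A : C} (hA : 𝓔.hat ω A) :
    ∃ (K W : C) (x : K ⟶ W) (y : W ⟶ A) (δ : Ext 𝓔.E A K),
      𝓔.IsETriangle x y δ ∧ ω W ∧ 𝓔.hat ω K := by
  obtain ⟨n, hn⟩ := hA
  obtain ⟨K, W, x, y, δ, h, hW, hK⟩ := hatN_le_succ hω n A hn
  exact ⟨K, W, x, y, δ, h, hW, n, hK⟩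

lemma hat.of_cone {U W G : C} {x : U ⟶ W} {y : W ⟶ G}
    {δ : Ext 𝓔.E G U} (h : 𝓔.IsETriangle x y δ) (hU : 𝓔.hat ω U) (hW : ω W) :
    𝓔.hat ω G := by
  obtain ⟨n, hn⟩ := hU
  exact ⟨n + 1, U, W, x, y, δ, h, hW, hn⟩

variable [𝓔.HasEnoughProj]

lemma hatN_le_rightPerp (hself : 𝓔.IsSelfOrthogonal ω) : ∀ n, 𝓔.hatN ω n ≤ 𝓔.rightPerp ω
  | 0 => hself
  | n + 1 => by
    rintro A ⟨K, W, x, y, δ, h, hW, hK⟩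
    exact rightPerp.of_cone h (hatN_le_rightPerp hself n K hK) (hself W hW)

/-- Both ends have the same length bound so that the horseshoe lowers them together; in length `0`
self-orthogonality splits the triangle. -/
lemma hatN_of_extension (hω : IsAdditiveSubcategory ω) (hself : 𝓔.IsSelfOrthogonal ω) (n : ℕ) :
    ∀ {X B Z : C} {x : X ⟶ B} {y : B ⟶ Z} {δ : Ext 𝓔.E Z X}, 𝓔.IsETriangle x y δ →
      𝓔.hatN ω n X → 𝓔.hatN ω n Z → 𝓔.hatN ω n B := by
  induction n with
  | zero =>
    intro X B Z x y δ h hX hZ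
    rw [rightPerp.ext_eq_zero (hself X hX) hZ δ] at h
    obtain ⟨φ, -, -⟩ := exists_iso_of_seqClass_eq (Eq.trans (Eq.symm h) (𝓔.s_zero X Z))
    exact hω.of_iso φ.symm (hω.biprod hX hZ)
  | succ n ih =>
    intro X B Z x y δ h hX hZ
    have hX' := hatN_le_rightPerp hself _ X hX
    obtain ⟨K, W, k, p, η, hη, hW, hK⟩ := hZ
    obtain ⟨K', W', k', p', η', hη', hW', hK'⟩ := hX
    obtain ⟨G, W₀, a, b, ε, c, d, ζ, h₁, h₂, h₃⟩ := exists_horseshoe hω h hX' hη hW hη' hW'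
    exact ⟨G, W₀, a, b, ε, h₁, h₂, ih h₃ hK' hK⟩

lemma hat.of_extension (hω : IsAdditiveSubcategory ω) (hself : 𝓔.IsSelfOrthogonal ω)
    {X B Z : C} {x : X ⟶ B} {y : B ⟶ Z} {δ : Ext 𝓔.E Z X} (h : 𝓔.IsETriangle x y δ)
    (hX : 𝓔.hat ω X) (hZ : 𝓔.hat ω Z) : 𝓔.hat ω B := by
  obtain ⟨m, hm⟩ := hX
  obtain ⟨n, hn⟩ := hZ
  exact ⟨max m n, hatN_of_extension hω hself _ h (hatN_mono hω (le_max_left m n) X hm)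
    (hatN_mono hω (le_max_right m n) Z hn)⟩

end Hat

/-! ### Coresolutions and the common equivalence -/

section Check

variable {ω : ObjectProperty C}

lemma check.exists_triangle (hω : IsAdditiveSubcategory ω) {A : C} (hA : 𝓔.check ω A) :
    ∃ (W K : C) (x : A ⟶ W) (y : W ⟶ K) (δ : Ext 𝓔.E K A),
      𝓔.IsETriangle x y δ ∧ ω W ∧ 𝓔.check ω K := by
  obtain ⟨_ | n, hn⟩ := hA
  · obtain ⟨O, hO⟩ := HasZeroObject.zero (C := C)
    exact ⟨_, _, _, _, _, 𝓔.isETriangle_id_right A hO, hn, 0, hω.of_isZero hO⟩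
  · obtain ⟨W, K, x, y, δ, h, hW, hK⟩ := hn
    exact ⟨W, K, x, y, δ, h, hW, n, hK⟩

lemma checkN_mono_property {ω' : ObjectProperty C} (h : ω ≤ ω') :
    ∀ n, 𝓔.checkN ω n ≤ 𝓔.checkN ω' n
  | 0 => h
  | n + 1 => by
    rintro A ⟨W, K, x, y, δ, hδ, hW, hK⟩
    exact ⟨W, K, x, y, δ, hδ, h W hW, checkN_mono_property h n K hK⟩

lemma check.of_cocone {A W K : C} {x : A ⟶ W} {y : W ⟶ K} {δ : Ext 𝓔.E K A}
    (h : 𝓔.IsETriangle x y δ) (hW : ω W) (hK : 𝓔.check ω K) : 𝓔.check ω A := by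
  obtain ⟨n, hn⟩ := hK
  exact ⟨n + 1, W, K, x, y, δ, h, hW, hn⟩

/-- Approximations for the objects of `𝒴ˇ`, where `𝒴` contains `ω` as a generator, is closed under
extensions, and contains the cones of the inflations from `𝒴` to `ω`. -/
theorem check_tfae (hω : IsAdditiveSubcategory ω) {Y : ObjectProperty C} (hωY : ω ≤ Y)
    (hgen : ∀ {A : C}, Y A → ∃ (K W : C) (x : K ⟶ W) (y : W ⟶ A) (δ : Ext 𝓔.E A K),
      𝓔.IsETriangle x y δ ∧ ω W ∧ Y K)
    (hcone : ∀ {U W G : C} {x : U ⟶ W} {y : W ⟶ G} {δ : Ext 𝓔.E G U},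
      𝓔.IsETriangle x y δ → Y U → ω W → Y G)
    (hext : ∀ {X B Z : C} {x : X ⟶ B} {y : B ⟶ Z} {δ : Ext 𝓔.E Z X},
      𝓔.IsETriangle x y δ → Y X → Y Z → Y B) (M : C) :
    List.TFAE [
      𝓔.check Y M,
      ∃ (U V : C) (x : U ⟶ V) (y : V ⟶ M) (δ : Ext 𝓔.E M U),
        𝓔.IsETriangle x y δ ∧ Y U ∧ 𝓔.check ω V,
      ∃ (U' V' : C) (x : M ⟶ U') (y : U' ⟶ V') (δ : Ext 𝓔.E V' M),
        𝓔.IsETriangle x y δ ∧ Y U' ∧ 𝓔.check ω V'] := by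
  -- Stated for every object because the induction for `h13` applies it to the cosyzygy `K`.
  have h32 : ∀ M : C, (∃ (U' V' : C) (x : M ⟶ U') (y : U' ⟶ V') (δ : Ext 𝓔.E V' M),
      𝓔.IsETriangle x y δ ∧ Y U' ∧ 𝓔.check ω V') →
      ∃ (U V : C) (x : U ⟶ V) (y : V ⟶ M) (δ : Ext 𝓔.E M U),
        𝓔.IsETriangle x y δ ∧ Y U ∧ 𝓔.check ω V := by
    rintro M ⟨U', V', x, y, δ, h, hU', hV'⟩
    obtain ⟨K, W, k, p, η, hη, hW, hK⟩ := hgen hU'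
    obtain ⟨G, a, b, c, d, ζ, -, -, -, h₁, h₂, -, -⟩ := 𝓔.et4_op _ _ _ _ _ _ h hη
    exact ⟨K, G, c, d, _, h₂, hK, check.of_cocone h₁ hW hV'⟩
  have h13 : ∀ (n : ℕ) (M : C), 𝓔.checkN Y n M →
      ∃ (U' V' : C) (x : M ⟶ U') (y : U' ⟶ V') (δ : Ext 𝓔.E V' M),
        𝓔.IsETriangle x y δ ∧ Y U' ∧ 𝓔.check ω V' := by
    intro n
    induction n with
    | zero =>
      intro M hM
      obtain ⟨O, hO⟩ := HasZeroObject.zero (C := C)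
      exact ⟨_, _, _, _, _, 𝓔.isETriangle_id_right M hO, hM, 0, hω.of_isZero hO⟩
    | succ n ih =>
      rintro M ⟨Y₀, K, x, y, δ, h, hY₀, hK⟩
      obtain ⟨U, V, u, v, η, hη, hU, hV⟩ := h32 K (ih K hK)
      obtain ⟨P, p, q, p', q', ε, ε', hP, hP'⟩ := h.exists_pullback hη
      exact ⟨P, V, p, q, ε, hP, hext hP' hU hY₀, hV⟩
  tfae_have 1 → 3 := fun ⟨n, hn⟩ => h13 n M hn
  tfae_have 3 → 2 := h32 M
  tfae_have 2 → 3 := by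
    rintro ⟨U, V, x, y, δ, h, hU, hV⟩
    obtain ⟨W, K, a, b, η, hη, hW, hK⟩ := hV.exists_triangle hω
    obtain ⟨G, k, k', d, e, ζ, -, -, -, h₁, h₂, -, -⟩ := 𝓔.et4 _ _ _ _ _ _ h hη
    exact ⟨G, K, d, e, _, h₂, hcone h₁ hU hW, hK⟩
  tfae_have 3 → 1 := by
    rintro ⟨U', V', x, y, δ, h, hU', n, hn⟩
    exact ⟨n + 1, U', V', x, y, δ, h, hU', checkN_mono_property hωY n V' hn⟩
  tfae_finish

end Check

end ExtriangulatedStructure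

end Extri

theorem mainTheorem5 {C : Type u} [Category.{v} C] [Preadditive C]
    [HasFiniteBiproducts C] [HasBinaryBiproducts C]
    (𝓔 : Extri.ExtriangulatedStructure.{w} C) [𝓔.HasEnoughProj] [𝓔.HasEnoughInj]
    (hKS : Extri.IsKrullSchmidt C)
    (ω : ObjectProperty C) (hω : Extri.IsAdditiveSubcategory ω) (hself : 𝓔.IsSelfOrthogonal ω)
    (M : C) :
    List.TFAE [
      𝓔.tilde ω M,
      ∃ (U V : C) (x : U ⟶ V) (y : V ⟶ M) (δ : Extri.Ext 𝓔.E M U),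
        𝓔.IsETriangle x y δ ∧ 𝓔.hat ω U ∧ 𝓔.check ω V,
      ∃ (U' V' : C) (x : M ⟶ U') (y : U' ⟶ V') (δ : Extri.Ext 𝓔.E V' M),
        𝓔.IsETriangle x y δ ∧ 𝓔.hat ω U' ∧ 𝓔.check ω V'] ∧
    List.TFAE [
      𝓔.check (𝓔.leftX ω) M,
      ∃ (U V : C) (x : U ⟶ V) (y : V ⟶ M) (δ : Extri.Ext 𝓔.E M U),
        𝓔.IsETriangle x y δ ∧ 𝓔.leftX ω U ∧ 𝓔.check ω V,
      ∃ (U' V' : C) (x : M ⟶ U') (y : U' ⟶ V') (δ : Extri.Ext 𝓔.E V' M),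
        𝓔.IsETriangle x y δ ∧ 𝓔.leftX ω U' ∧ 𝓔.check ω V'] :=
  ⟨Extri.ExtriangulatedStructure.check_tfae hω (fun _ h => ⟨0, h⟩)
      (fun h => h.exists_triangle hω) Extri.ExtriangulatedStructure.hat.of_cone
      (Extri.ExtriangulatedStructure.hat.of_extension hω hself) M,
    Extri.ExtriangulatedStructure.check_tfae hω
      (Extri.ExtriangulatedStructure.le_leftX hω hself)
      (fun h => h.exists_triangle) (Extri.ExtriangulatedStructure.leftX.of_cone hself)
      (Extri.ExtriangulatedStructure.leftX.of_extension hω) M⟩
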